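/- A (finite) projective space is a finite set $P$ of points together with a set of lines such that any two distinct points lie on exactly one line, every line has at least three points, and (Veblen–Young) for any four distinct points $a,b,c,e$, if the lines $ab$ and $ce$ meet, then the lines $ac$ and $be$ meet. A subspace is a set of points that contains, with any two of its points, the whole line through them; the span of a set of points is the smallest subspace containing it. The space has dimension $d$ if it is spanned by $d+1$ independent points (none of them lies in the span of the others), and order $n$ if every line has exactly $n+1$ points. A hyperplane is a maximal proper subspace. For a real matrix $M$ without zero entries, $\operatorname{sign}(M)$ is the matrix of the signs of its entries. The sign rank of a $\pm1$ matrix $S$ is the minimum of $\operatorname{rank}(M)$ (over $\mathbb{R}$) over all real matrices $M$ with $\operatorname{sign}(M)=S$. A set $C$ of columns of $S$ is shattered if each of the $2^{|C|}$ sign patterns on $C$ appears in some row of $S$ restricted to $C$; the VC dimension of $S$ is the maximum size of a shattered set of columns. **Theorem.** Let $d\ge 2$ and $n\ge 3$, let $P$ be the set of points of a $d$-dimensional projective space of order $n$, and let $H$ be its set of hyperplanes. Let $A\in\{\pm1\}^{P\times H}$ be the signed point–hyperplane incidence matrix, with $A_{p,h}=1$ if $p\in h$ and $A_{p,h}=-1$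 if $p\notin h$. Then $A$ is $N\times N$, that is, $|P|=|H|=N$, with $N=\frac{n^{d+1}-1}{n-1}$; the VC dimension of $A$ is $d$; and $$\text{sign-rank}(A)\;>\;\frac{n^d-1}{n^{\frac{d-1}{2}}(n-1)}\;\ge\; N^{\frac12-\frac1{2d}}.$$ -/

import Mathlib

/-- The point-line geometry `(P, L)` is a projective space (Veblen–Young axioms). -/
structure IsProjectiveSpace (P L : Type*) [Membership P L] : Prop where
  /-- Two distinct points lie on exactly one common line. -/
  existsUnique_line : ∀ p q : P, p ≠ q → ∃! l : L, p ∈ l ∧ q ∈ l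
  /-- For distinct points `a, b, c, d`, if the lines `ab` and `cd` meet, so do `ac` and `bd`. -/
  veblen_young : ∀ (a b c d : P) (ab cd ac bd : L),
    a ≠ b → a ≠ c → a ≠ d → b ≠ c → b ≠ d → c ≠ d →
    a ∈ ab → b ∈ ab → c ∈ cd → d ∈ cd → a ∈ ac → c ∈ ac → b ∈ bd → d ∈ bd →
    (∃ p : P, p ∈ ab ∧ p ∈ cd) → ∃ q : P, q ∈ ac ∧ q ∈ bd
  /-- Every line has at least three points. -/
  three_points : ∀ l : L, ∃ a b c : P, a ≠ b ∧ a ≠ c ∧ b ≠ c ∧ a ∈ l ∧ b ∈ l ∧ c ∈ l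

namespace IsProjectiveSpace

/-- A subspace: a set of points containing, with any two distinct points, all points of every
line through them. -/
def IsSubspace {P : Type*} (L : Type*) [Membership P L] (U : Set P) : Prop :=
  ∀ p ∈ U, ∀ q ∈ U, p ≠ q → ∀ l : L, p ∈ l → q ∈ l → ∀ r : P, r ∈ l → r ∈ U

/-- The subspace spanned by a set of points. -/
def span {P : Type*} (L : Type*) [Membership P L] (X : Set P) : Set P :=
  ⋂₀ {U | IsSubspace L U ∧ X ⊆ U}

/-- A set of points is independent if none of them lies in the span of the others. -/
def Independent {P : Type*} (L : Type*) [Membership P L] (X : Set P) : Prop :=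
  ∀ x ∈ X, x ∉ span L (X \ {x})

/-- The space has dimension `d`: it has a basis (an independent spanning set) of `d + 1` points. -/
def HasDimension (P L : Type*) [Membership P L] (d : ℕ) : Prop :=
  ∃ B : Finset P, B.card = d + 1 ∧ Independent L (B : Set P) ∧ span L (B : Set P) = Set.univ

/-- The space has order `n`: every line has exactly `n + 1` points. -/
def HasOrder (P L : Type*) [Membership P L] (n : ℕ) : Prop :=
  ∀ l : L, Configuration.pointCount P l = n + 1

/-- A hyperplane: a maximal proper subspace. -/
def IsHyperplane {P : Type*} (L : Type*) [Membership P L] (U : Set P) : Prop :=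
  Maximal (fun W : Set P => IsSubspace L W ∧ W ≠ Set.univ) U

/-- The type of hyperplanes. -/
def Hyperplane (P L : Type*) [Membership P L] : Type _ :=
  {U : Set P // IsHyperplane L U}

noncomputable instance {P L : Type*} [Membership P L] [Fintype P] : Fintype (Hyperplane P L) :=
  haveI : Finite (Hyperplane P L) := inferInstanceAs (Finite {U : Set P // IsHyperplane L U})
  Fintype.ofFinite _

open Classical in
/-- The signed point-hyperplane incidence matrix; `ℤˣ = {1, -1}`. -/
noncomputable def signedIncidence (P L : Type*) [Membership P L] :
    Matrix P (Hyperplane P L) ℤˣ :=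
  Matrix.of fun p h => if p ∈ h.1 then 1 else -1

end IsProjectiveSpace

namespace SignMatrix

/-- The sign rank of a sign matrix: the least rank of a real matrix with this sign pattern. -/
noncomputable def signRank {R C : Type*} [Fintype C] (S : Matrix R C ℤˣ) : ℕ :=
  sInf {r | ∃ M : Matrix R C ℝ, (∀ i j, Real.sign (M i j) = ((S i j : ℤ) : ℝ)) ∧ M.rank = r}

/-- A set of columns is shattered if every sign pattern on it is the restriction of a row. -/
def Shattered {R C : Type*} (S : Matrix R C ℤˣ) (T : Finset C) : Prop :=
  ∀ v : C → ℤˣ, ∃ i, ∀ j ∈ T, S i j = v j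

/-- The VC dimension: the maximum size of a shattered set of columns. -/
noncomputable def vcDim {R C : Type*} (S : Matrix R C ℤˣ) : ℕ :=
  sSup {k | ∃ T : Finset C, T.card = k ∧ Shattered S T}

end SignMatrix

/-! Forster's method bounds the sign rank `k` of a sign matrix from below. Realise the matrix by
vectors `x i`, `y j` in `ℝ^k` and choose near each `x i` a basis that still has the right signs
against all `y j`. The logarithmic potential of these bases is bounded below, by Hadamard's
inequality, and stretching a near-minimiser along a unit vector `v` shows that the normalised basis
vectors have almost as much mass along `v` as an isotropic family. Comparing the sum of the squared
inner products with the bilinear form of a real matrix `G` that has the same signs and entries of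
modulus at least `γ` gives `γ √(|R| |C|) ≤ k ‖G‖`. Using bases and near-minimisers avoids both the
general position argument and the attainment of the minimum.

In a projective space of order `n` the cone construction shows that a flat of rank `r` has `1 + n +
⋯ + n ^ (r - 1)` points, and double counting of pairs (hyperplane, point) then counts the
hyperplanes through a flat. Hence the incidence matrix `M` is that of a symmetric design, and
Forster's bound is applied to `G = M - ρ J`, where `J` is the all-ones matrix and `ρ` the density of
`M`. The inequality is strict because `1 + n + ⋯ + n ^ (d - 1)` is coprime to `n`, so it is no
integer multiple of `√(n ^ (d - 1))`. For the VC dimension, the intersection loses rank with each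
hyperplane of a shattered set, and hyperplanes spanned by the facets of a simplex show that this is
sharp.
-/

namespace SignMatrix

open Filter Topology
open NormedSpace (normalize)
open scoped Matrix RealInnerProductSpace

theorem Shattered.mono {R C : Type*} {S : Matrix R C ℤˣ} {T T' : Finset C}
    (hT : Shattered S T) (hT' : T' ⊆ T) : Shattered S T' := fun v =>
  (hT v).imp fun _ hi j hj => hi j (hT' hj)

theorem exists_basis_forall_mem {ι 𝕜 E : Type*} [NontriviallyNormedField 𝕜]
    [NormedAddCommGroup E] [NormedSpace 𝕜 E] (b : Module.Basis ι 𝕜 E) {U : Set E}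
    (hU : (interior U).Nonempty) : ∃ z : Module.Basis ι 𝕜 E, ∀ l, z l ∈ U := by
  have hspan : Submodule.span 𝕜 U = ⊤ :=
    (Submodule.span 𝕜 U).eq_top_of_nonempty_interior'
      (hU.mono (interior_mono Submodule.subset_span))
  let z := Module.Basis.ofSpan hspan.ge
  refine ⟨z.reindex (z.indexEquiv b), fun l => ?_⟩
  rw [Module.Basis.reindex_apply]
  exact Module.Basis.ofSpan_subset hspan.ge (Set.mem_range_self _)

variable {ι R C E : Type*} [Fintype ι] [NormedAddCommGroup E] [InnerProductSpace ℝ E]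

/-- `Realizes S x y`: the Gram matrix of the vectors `x i` against the vectors `y j` has sign
pattern `S`. -/
def Realizes (S : Matrix R C ℤˣ) (x : R → E) (y : C → E) : Prop :=
  ∀ i j, 0 < ((S i j : ℤ) : ℝ) * ⟪x i, y j⟫

theorem exists_inner_eq [Fintype C] (M : Matrix R C ℝ) :
    ∃ (x : R → EuclideanSpace ℝ (Fin M.rank)) (y : C → EuclideanSpace ℝ (Fin M.rank)),
      ∀ i j, ⟪x i, y j⟫ = M i j := by
  classical
  let b := Module.finBasisOfFinrankEq ℝ (LinearMap.range M.mulVecLin) (n := M.rank) rfl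
  have hcol (j) : M.mulVecLin (Pi.single j 1) ∈ LinearMap.range M.mulVecLin :=
    LinearMap.mem_range_self _ _
  refine ⟨fun i => WithLp.toLp 2 fun l => (b l : R → ℝ) i,
    fun j => WithLp.toLp 2 fun l => b.repr ⟨_, hcol j⟩ l, fun i j => ?_⟩
  have h := congrArg (fun v : LinearMap.range M.mulVecLin => (v : R → ℝ) i)
    (b.sum_repr ⟨_, hcol j⟩)
  simp only [Submodule.coe_sum, Finset.sum_apply, Submodule.coe_smul, Pi.smul_apply,
    smul_eq_mul, Matrix.mulVecLin_apply, Matrix.mulVec_single_one, Matrix.col_apply] at h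
  rw [← h]
  simp [PiLp.inner_apply]

theorem exists_realizes_signRank [Fintype C] (S : Matrix R C ℤˣ) :
    ∃ x y : _ → EuclideanSpace ℝ (Fin (signRank S)), Realizes S x y := by
  have hsign (i j) : Real.sign ((S i j : ℤ) : ℝ) = ((S i j : ℤ) : ℝ) := by
    rcases Int.units_eq_one_or (S i j) with h | h <;> simp [h, Real.sign_of_neg]
  obtain ⟨M, hM, hrank⟩ := Nat.sInf_mem (s := {r | ∃ M : Matrix R C ℝ,
    (∀ i j, Real.sign (M i j) = ((S i j : ℤ) : ℝ)) ∧ M.rank = r}) ⟨_, _, hsign, rfl⟩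
  obtain ⟨x, y, hxy⟩ := exists_inner_eq M
  rw [signRank, ← hrank]
  refine ⟨x, y, fun i j => ?_⟩
  rw [hxy, ← hM]
  refine Real.sign_mul_pos_of_ne_zero _ fun h => ?_
  have hzero : ((S i j : ℤ) : ℝ) = 0 := by rw [← hM, h, Real.sign_zero]
  exact (S i j).ne_zero (by exact_mod_cast hzero)

theorem Realizes.normalize_normalize {S : Matrix R C ℤˣ} {x : R → E} {y : C → E}
    (h : Realizes S x y) : Realizes S (fun i => normalize (x i)) fun j => normalize (y j) := by
  intro i j
  have hx : 0 < ‖x i‖ := norm_pos_iff.2 fun h0 => by simpa [h0] using h i j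
  have hy : 0 < ‖y j‖ := norm_pos_iff.2 fun h0 => by simpa [h0] using h i j
  have hinner : ⟪normalize (x i), normalize (y j)⟫ = ‖x i‖⁻¹ * ‖y j‖⁻¹ * ⟪x i, y j⟫ := by
    simp only [NormedSpace.normalize, real_inner_smul_left, real_inner_smul_right]
    ring
  rw [hinner, mul_left_comm]
  exact mul_pos (by positivity) (h i j)

theorem Realizes.mul_sq_inner_le {S : Matrix R C ℤˣ} {x : R → E} {y : C → E} (h : Realizes S x y)
    {i : R} {j : C} (hx : ‖x i‖ = 1) (hy : ‖y j‖ = 1) {γ g : ℝ} (hγ : 0 ≤ γ)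
    (hg : γ ≤ ((S i j : ℤ) : ℝ) * g) : γ * ⟪x i, y j⟫ ^ 2 ≤ g * ⟪x i, y j⟫ := by
  have hS : ((S i j : ℤ) : ℝ) ^ 2 = 1 := by
    rcases Int.units_eq_one_or (S i j) with hS | hS <;> simp [hS]
  have hle : ((S i j : ℤ) : ℝ) * ⟪x i, y j⟫ ≤ 1 := by
    have hcs : |⟪x i, y j⟫| ≤ 1 := by simpa [hx, hy] using abs_real_inner_le_norm (x i) (y j)
    rcases Int.units_eq_one_or (S i j) with hS | hS
    · simpa [hS] using (abs_le.1 hcs).2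
    · simpa [hS, neg_le] using (abs_le.1 hcs).1
  calc γ * ⟪x i, y j⟫ ^ 2 = γ * (((S i j : ℤ) : ℝ) * ⟪x i, y j⟫) ^ 2 := by rw [mul_pow, hS, one_mul]
    _ ≤ γ * (((S i j : ℤ) : ℝ) * ⟪x i, y j⟫) := by
      gcongr
      exact pow_le_of_le_one (h i j).le hle two_ne_zero
    _ ≤ ((S i j : ℤ) : ℝ) * g * (((S i j : ℤ) : ℝ) * ⟪x i, y j⟫) := by
      gcongr
      exact (h i j).le
    _ = g * ⟪x i, y j⟫ := by linear_combination g * ⟪x i, y j⟫ * hS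

theorem abs_det_le_prod_norm [DecidableEq ι] (b : OrthonormalBasis ι ℝ E) (v : ι → E) :
    |b.toBasis.det v| ≤ ∏ i, ‖v i‖ := by
  let e := Fintype.equivFin ι
  let b' := b.reindex e
  have : Fact (Module.finrank ℝ E = Fintype.card ι) := ⟨Module.finrank_eq_card_basis b.toBasis⟩
  have h := b'.toBasis.orientation.abs_volumeForm_apply_le (v ∘ e.symm)
  rw [b'.toBasis.orientation.volumeForm_robust' b', OrthonormalBasis.reindex_toBasis,
    Module.Basis.det_reindex, Function.comp_assoc, e.symm_comp_self, Function.comp_id] at h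
  rwa [← e.symm.prod_comp]

theorem norm_add_smul_inner_sq {v : E} (hv : ‖v‖ = 1) (r : ℝ) (y : E) :
    ‖y + ((r - 1) * ⟪v, y⟫) • v‖ ^ 2 = ‖y‖ ^ 2 + (r ^ 2 - 1) * ⟪v, y⟫ ^ 2 := by
  rw [norm_add_sq_real, inner_smul_right, norm_smul, hv, mul_one, Real.norm_eq_abs, sq_abs,
    real_inner_comm]
  ring

/-- The linear automorphism of `E` that multiplies the unit vector `v` by `r` and fixes its
orthogonal complement: a perturbation against which near-minimisers of `potential` are tested. -/
noncomputable def stretch {v : E} (hv : ‖v‖ = 1) {r : ℝ} (hr : r ≠ 0) : E ≃ₗ[ℝ] E :=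
  LinearEquiv.dilatransvection (f := (r - 1) • innerₛₗ ℝ v) (v := v) (by simpa [hv] using hr)

theorem stretch_apply {v : E} (hv : ‖v‖ = 1) {r : ℝ} (hr : r ≠ 0) (y : E) :
    stretch hv hr y = y + ((r - 1) * ⟪v, y⟫) • v := by
  simp [stretch, LinearEquiv.dilatransvection.apply]

theorem det_stretch [FiniteDimensional ℝ E] {v : E} (hv : ‖v‖ = 1) {r : ℝ} (hr : r ≠ 0) :
    LinearMap.det (stretch hv hr : E →ₗ[ℝ] E) = r := by
  simp [stretch, LinearEquiv.dilatransvection.coe_toLinearMap, hv]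

theorem log_norm_stretch_le {v : E} (hv : ‖v‖ = 1) {r : ℝ} (hr : r ≠ 0) {y : E} (hy : y ≠ 0) :
    Real.log ‖stretch hv hr y‖
      ≤ Real.log ‖y‖ + (r ^ 2 - 1) / 2 * ⟪normalize y, v⟫ ^ 2 := by
  have hunit : ‖stretch hv hr (normalize y)‖ ^ 2 = 1 + (r ^ 2 - 1) * ⟪normalize y, v⟫ ^ 2 := by
    rw [stretch_apply, norm_add_smul_inner_sq hv, NormedSpace.norm_normalize hy, one_pow,
      real_inner_comm]
  have hpos : 0 < ‖stretch hv hr (normalize y)‖ := by simpa using hy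
  have hlog : 2 * Real.log ‖stretch hv hr (normalize y)‖
      ≤ ‖stretch hv hr (normalize y)‖ ^ 2 - 1 := by
    simpa using Real.log_le_sub_one_of_pos (pow_pos hpos 2)
  have hmul : ‖stretch hv hr y‖ = ‖y‖ * ‖stretch hv hr (normalize y)‖ := by
    conv_lhs => rw [← NormedSpace.norm_smul_normalize y, map_smul, norm_smul, norm_norm]
  rw [hmul, Real.log_mul (norm_ne_zero_iff.2 hy) hpos.ne']
  linarith

variable [Fintype R]

/-- The logarithmic potential of a family of bases `z i` under the change of coordinates `A`. It
does not change when `A` is rescaled, and a near-minimiser `A` brings the normalised vectors of the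
bases into almost isotropic position. -/
noncomputable def potential (z : R → Module.Basis ι ℝ E) (A : E ≃ₗ[ℝ] E) : ℝ :=
  ∑ i, ∑ l, Real.log ‖A (z i l)‖ - Fintype.card R * Real.log |LinearMap.det (A : E →ₗ[ℝ] E)|

theorem bddBelow_range_potential (b : OrthonormalBasis ι ℝ E) (z : R → Module.Basis ι ℝ E) :
    BddBelow (Set.range (potential z)) := by
  classical
  refine ⟨∑ i, Real.log |b.toBasis.det (z i)|, ?_⟩
  rintro _ ⟨A, rfl⟩
  have hdet : LinearMap.det (A : E →ₗ[ℝ] E) ≠ 0 := A.isUnit_det'.ne_zero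
  have hadamard (i) : Real.log |LinearMap.det (A : E →ₗ[ℝ] E)| + Real.log |b.toBasis.det (z i)|
      ≤ ∑ l, Real.log ‖A (z i l)‖ := by
    have hz : b.toBasis.det (z i) ≠ 0 := (b.toBasis.isUnit_det (z i)).ne_zero
    have hcomp : b.toBasis.det (A ∘ z i) = LinearMap.det (A : E →ₗ[ℝ] E) * b.toBasis.det (z i) :=
      b.toBasis.det_comp _ _
    rw [← Real.log_mul (abs_ne_zero.2 hdet) (abs_ne_zero.2 hz), ← abs_mul, ← hcomp,
      ← Real.log_prod fun l _ => by simpa using (z i).ne_zero l]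
    exact Real.log_le_log (abs_pos.2 (hcomp ▸ mul_ne_zero hdet hz)) (abs_det_le_prod_norm b _)
  have hsum := Finset.sum_le_sum fun i (_ : i ∈ Finset.univ) => hadamard i
  rw [Finset.sum_add_distrib, Finset.sum_const, Finset.card_univ, nsmul_eq_mul] at hsum
  rw [potential]
  linarith

theorem potential_trans_stretch_le [FiniteDimensional ℝ E] (z : R → Module.Basis ι ℝ E)
    (A : E ≃ₗ[ℝ] E) {v : E} (hv : ‖v‖ = 1) {r : ℝ} (hr : r ≠ 0) :
    potential z (A.trans (stretch hv hr)) ≤ potential z A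
      + (r ^ 2 - 1) / 2 * ∑ i, ∑ l, ⟪normalize (A (z i l)), v⟫ ^ 2
      - Fintype.card R * Real.log |r| := by
  have hlog : ∑ i, ∑ l, Real.log ‖stretch hv hr (A (z i l))‖ ≤ ∑ i, ∑ l, Real.log ‖A (z i l)‖
      + (r ^ 2 - 1) / 2 * ∑ i, ∑ l, ⟪normalize (A (z i l)), v⟫ ^ 2 := by
    simp only [Finset.mul_sum, ← Finset.sum_add_distrib]
    exact Finset.sum_le_sum fun i _ => Finset.sum_le_sum fun l _ =>
      log_norm_stretch_le hv hr (by simpa using (z i).ne_zero l)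
  have hdet : Real.log |LinearMap.det (A.trans (stretch hv hr) : E →ₗ[ℝ] E)|
      = Real.log |r| + Real.log |LinearMap.det (A : E →ₗ[ℝ] E)| := by
    rw [LinearEquiv.coe_trans, LinearMap.det_comp, det_stretch, abs_mul,
      Real.log_mul (abs_ne_zero.2 hr) (abs_ne_zero.2 A.isUnit_det'.ne_zero)]
  simp only [potential, hdet, LinearEquiv.trans_apply]
  linarith

theorem exists_almost_isotropic (b : OrthonormalBasis ι ℝ E)
    (z : R → Module.Basis ι ℝ E) {δ : ℝ} (hδ : 0 < δ) :
    ∃ A : E ≃ₗ[ℝ] E, ∀ v : E, ‖v‖ = 1 →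
      Fintype.card R - δ ≤ ∑ i, ∑ l, ⟪normalize (A (z i l)), v⟫ ^ 2 := by
  have := b.toBasis.finiteDimensional_of_finite
  obtain ⟨r, hr, hrδ⟩ : ∃ r : ℝ, 1 < r ∧ Fintype.card R - δ / 2 < Fintype.card R * (r ^ 2)⁻¹ := by
    have hlim : Tendsto (fun r : ℝ => Fintype.card R * (r ^ 2)⁻¹) (𝓝[>] 1)
        (𝓝 (Fintype.card R)) := by
      have : ContinuousAt (fun r : ℝ => Fintype.card R * (r ^ 2)⁻¹) 1 := by fun_prop (disch := simp)
      simpa using this.tendsto.mono_left nhdsWithin_le_nhds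
    exact (eventually_mem_nhdsWithin.and (hlim.eventually_const_lt (by linarith))).exists
  have ht : 0 < r ^ 2 - 1 := by nlinarith
  obtain ⟨A, hA⟩ := exists_lt_of_ciInf_lt
    (lt_add_of_pos_right (⨅ A, potential z A) (show 0 < (r ^ 2 - 1) * δ / 4 by positivity))
  refine ⟨A, fun v hv => ?_⟩
  set Q := ∑ i, ∑ l, ⟪normalize (A (z i l)), v⟫ ^ 2
  have hr0 : r ≠ 0 := by positivity
  have hmin := (ciInf_le (bddBelow_range_potential b z) _).trans
    (potential_trans_stretch_le z A hv hr0)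
  have hlog : 1 - (r ^ 2)⁻¹ ≤ 2 * Real.log |r| := by
    simpa using Real.one_sub_inv_le_log_of_pos (show 0 < r ^ 2 by positivity)
  have hinv : 1 - (r ^ 2)⁻¹ = (r ^ 2 - 1) * (r ^ 2)⁻¹ := by field_simp
  have hN := mul_le_mul_of_nonneg_left hlog (Nat.cast_nonneg (α := ℝ) (Fintype.card R))
  refine le_of_mul_le_mul_left (?_ : (r ^ 2 - 1) * (Fintype.card R - δ) ≤ (r ^ 2 - 1) * Q) ht
  have := mul_lt_mul_of_pos_left hrδ ht
  rw [hinv] at hN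
  linarith

theorem Realizes.exists_almost_isotropic [Finite C] [Nonempty R] (b : OrthonormalBasis ι ℝ E)
    {S : Matrix R C ℤˣ} {x : R → E} {y : C → E} (h : Realizes S x y) {δ : ℝ} (hδ : 0 < δ) :
    ∃ (u : ι → R → E) (w : C → E), (∀ l i, ‖u l i‖ = 1) ∧ (∀ j, ‖w j‖ = 1) ∧
      (∀ l, Realizes S (u l) w) ∧
      ∀ j, Fintype.card R - δ ≤ ∑ i, ∑ l, ⟪u l i, w j⟫ ^ 2 := by
  have := b.toBasis.finiteDimensional_of_finite
  have hz (i) : ∃ z : Module.Basis ι ℝ E, ∀ l j, 0 < ((S i j : ℤ) : ℝ) * ⟪z l, y j⟫ := by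
    have hopen : IsOpen {v | ∀ j, 0 < ((S i j : ℤ) : ℝ) * ⟪v, y j⟫} := by
      simp only [Set.ofPred_forall]
      exact isOpen_iInter_of_finite fun j => isOpen_lt continuous_const (by fun_prop)
    exact exists_basis_forall_mem b.toBasis ⟨x i, hopen.subset_interior_iff.2 subset_rfl (h i)⟩
  choose z hz using hz
  obtain ⟨A, hA⟩ := SignMatrix.exists_almost_isotropic b z hδ
  have hinner (v j) : ⟪A v, LinearMap.adjoint (A.symm : E →ₗ[ℝ] E) (y j)⟫ = ⟪v, y j⟫ := by
    rw [LinearMap.adjoint_inner_right, LinearEquiv.coe_coe, A.symm_apply_apply]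
  have hAz (i l) : A (z i l) ≠ 0 := by simpa using (z i).ne_zero l
  have hy (j) : LinearMap.adjoint (A.symm : E →ₗ[ℝ] E) (y j) ≠ 0 := fun h0 => by
    obtain ⟨i⟩ := ‹Nonempty R›
    simpa [← hinner, h0] using h i j
  refine ⟨fun l i => normalize (A (z i l)),
    fun j => normalize (LinearMap.adjoint (A.symm : E →ₗ[ℝ] E) (y j)),
    fun l i => NormedSpace.norm_normalize (hAz i l), fun j => NormedSpace.norm_normalize (hy j),
    fun l i j => ?_, fun j => ?_⟩
  · exact Realizes.normalize_normalize (fun i j => (hinner _ j).symm ▸ hz i l j) i j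
  · exact hA _ (NormedSpace.norm_normalize (hy j))

open scoped Matrix.Norms.L2Operator in
theorem sum_mul_inner_le_opNorm [Fintype C] [DecidableEq C] [FiniteDimensional ℝ E]
    (G : Matrix R C ℝ) (u : R → E) (w : C → E) :
    ∑ i, ∑ j, G i j * ⟪u i, w j⟫ ≤ ‖G‖ * (√(∑ i, ‖u i‖ ^ 2) * √(∑ j, ‖w j‖ ^ 2)) := by
  let b := stdOrthonormalBasis ℝ E
  have hcoord (l) : ∑ i, ∑ j, G i j * (⟪u i, b l⟫ * ⟪b l, w j⟫)
      ≤ ‖G‖ * (√(∑ i, ⟪u i, b l⟫ ^ 2) * √(∑ j, ⟪b l, w j⟫ ^ 2)) := by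
    have h := le_trans (real_inner_le_norm (WithLp.toLp 2 fun i => ⟪u i, b l⟫)
      (WithLp.toLp 2 (G *ᵥ fun j => ⟪b l, w j⟫)))
      (mul_le_mul_of_nonneg_left (Matrix.l2_opNorm_mulVec G (WithLp.toLp 2 fun j => ⟪b l, w j⟫))
        (norm_nonneg _))
    simpa [EuclideanSpace.inner_eq_star_dotProduct, EuclideanSpace.norm_eq, Matrix.mulVec,
      dotProduct, Finset.mul_sum, mul_comm, mul_assoc, mul_left_comm] using h
  have hexp (i j) : G i j * ⟪u i, w j⟫ = ∑ l, G i j * (⟪u i, b l⟫ * ⟪b l, w j⟫) := by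
    rw [← b.sum_inner_mul_inner, Finset.mul_sum]
  calc ∑ i, ∑ j, G i j * ⟪u i, w j⟫
      = ∑ l, ∑ i, ∑ j, G i j * (⟪u i, b l⟫ * ⟪b l, w j⟫) := by
        simp only [hexp]
        exact (Finset.sum_congr rfl fun i _ => Finset.sum_comm).trans Finset.sum_comm
    _ ≤ ‖G‖ * ∑ l, √(∑ i, ⟪u i, b l⟫ ^ 2) * √(∑ j, ⟪b l, w j⟫ ^ 2) := by
        rw [Finset.mul_sum]
        exact Finset.sum_le_sum fun l _ => hcoord l
    _ ≤ ‖G‖ * (√(∑ l, ∑ i, ⟪u i, b l⟫ ^ 2) * √(∑ l, ∑ j, ⟪b l, w j⟫ ^ 2)) := by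
        gcongr
        exact Real.sum_sqrt_mul_sqrt_le _ (fun _ => by positivity) fun _ => by positivity
    _ = ‖G‖ * (√(∑ i, ‖u i‖ ^ 2) * √(∑ j, ‖w j‖ ^ 2)) := by
        rw [Finset.sum_comm, Finset.sum_comm (f := fun l j => ⟪b l, w j⟫ ^ 2)]
        simp only [b.sum_sq_inner_left, b.sum_sq_inner_right]

open scoped Matrix.Norms.L2Operator in
theorem mul_card_le_of_almost_isotropic [Fintype C] [DecidableEq C] [FiniteDimensional ℝ E]
    {S : Matrix R C ℤˣ} {G : Matrix R C ℝ} {γ : ℝ} (hγ0 : 0 ≤ γ)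
    (hγ : ∀ i j, γ ≤ ((S i j : ℤ) : ℝ) * G i j) {u : ι → R → E} {w : C → E}
    (hu : ∀ l i, ‖u l i‖ = 1) (hw : ∀ j, ‖w j‖ = 1) (huw : ∀ l, Realizes S (u l) w) {μ : ℝ}
    (hμ : ∀ j, μ ≤ ∑ i, ∑ l, ⟪u l i, w j⟫ ^ 2) :
    γ * (Fintype.card C * μ) ≤ Fintype.card ι * ‖G‖ * √(Fintype.card R * Fintype.card C) := by
  have hnorm (i) : ‖∑ l, u l i‖ ≤ Fintype.card ι := by
    simpa [hu] using norm_sum_le Finset.univ fun l => u l i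
  calc γ * (Fintype.card C * μ)
      = γ * ∑ _j : C, μ := by simp
    _ ≤ γ * ∑ j, ∑ i, ∑ l, ⟪u l i, w j⟫ ^ 2 := by gcongr; exact hμ _
    _ = ∑ i, ∑ j, ∑ l, γ * ⟪u l i, w j⟫ ^ 2 := by
      simp only [Finset.mul_sum]
      exact Finset.sum_comm
    _ ≤ ∑ i, ∑ j, ∑ l, G i j * ⟪u l i, w j⟫ :=
      Finset.sum_le_sum fun i _ => Finset.sum_le_sum fun j _ => Finset.sum_le_sum fun l _ =>
        (huw l).mul_sq_inner_le (hu l i) (hw j) hγ0 (hγ i j)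
    _ = ∑ i, ∑ j, G i j * ⟪∑ l, u l i, w j⟫ := by simp only [sum_inner, Finset.mul_sum]
    _ ≤ ‖G‖ * (√(∑ i, ‖∑ l, u l i‖ ^ 2) * √(∑ j, ‖w j‖ ^ 2)) := sum_mul_inner_le_opNorm _ _ _
    _ ≤ ‖G‖ * (√(∑ i : R, (Fintype.card ι : ℝ) ^ 2) * √(∑ j, ‖w j‖ ^ 2)) := by
      gcongr
      exact hnorm _
    _ = Fintype.card ι * ‖G‖ * √(Fintype.card R * Fintype.card C) := by
      simp only [Finset.sum_const, Finset.card_univ, nsmul_eq_mul, Nat.cast_nonneg, Real.sqrt_mul,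
        Real.sqrt_sq, hw, one_pow, mul_one]
      ring

open scoped Matrix.Norms.L2Operator in
theorem mul_sqrt_card_le_signRank_mul_opNorm [Fintype C] [DecidableEq C] (S : Matrix R C ℤˣ)
    (G : Matrix R C ℝ) {γ : ℝ} (hγ : ∀ i j, γ ≤ ((S i j : ℤ) : ℝ) * G i j) :
    γ * √(Fintype.card R * Fintype.card C) ≤ signRank S * ‖G‖ := by
  rcases le_or_gt γ 0 with hγ0 | hγ0
  · exact (mul_nonpos_of_nonpos_of_nonneg hγ0 (Real.sqrt_nonneg _)).trans (by positivity)
  rcases (Real.sqrt_nonneg (Fintype.card R * Fintype.card C)).eq_or_lt with hm | hm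
  · simpa [← hm] using by positivity
  have : Nonempty R := not_isEmpty_iff.1 fun _ => by simp at hm
  obtain ⟨x, y, hxy⟩ := exists_realizes_signRank S
  have hbound (δ : ℝ) (hδ : 0 < δ) : γ * (Fintype.card C * (Fintype.card R - δ))
      ≤ signRank S * ‖G‖ * √(Fintype.card R * Fintype.card C) := by
    obtain ⟨u, w, hu, hw, huw, hiso⟩ :=
      hxy.exists_almost_isotropic (EuclideanSpace.basisFun _ ℝ) hδ
    simpa using mul_card_le_of_almost_isotropic hγ0.le hγ hu hw huw hiso
  have hlim : Tendsto (fun δ : ℝ => γ * (Fintype.card C * (Fintype.card R - δ))) (𝓝[>] 0)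
      (𝓝 (γ * (Fintype.card C * (Fintype.card R - 0)))) :=
    (Continuous.tendsto (by fun_prop) 0).mono_left nhdsWithin_le_nhds
  refine le_of_mul_le_mul_right ?_ hm
  calc γ * √(Fintype.card R * Fintype.card C) * √(Fintype.card R * Fintype.card C)
      = γ * (Fintype.card C * (Fintype.card R - 0)) := by
        rw [mul_assoc, Real.mul_self_sqrt (by positivity)]
        ring
    _ ≤ signRank S * ‖G‖ * √(Fintype.card R * Fintype.card C) :=
        le_of_tendsto hlim (eventually_mem_nhdsWithin.mono hbound)

open scoped Matrix.Norms.L2Operator in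
theorem opNorm_le_sqrt_of_mul_transpose_eq [Fintype C] [DecidableEq C] [DecidableEq R]
    {G : Matrix R C ℝ} {α β : ℝ} (hβ : β ≤ 0)
    (hG : G * Gᵀ = α • (1 : Matrix R R ℝ) + β • Matrix.vecMulVec 1 1) : ‖G‖ ≤ √α := by
  have hquad (x : R → ℝ) : (Gᵀ *ᵥ x) ⬝ᵥ (Gᵀ *ᵥ x) = α * (x ⬝ᵥ x) + β * (1 ⬝ᵥ x) ^ 2 := by
    rw [Matrix.mulVec_transpose, ← Matrix.dotProduct_mulVec, ← Matrix.mulVec_transpose,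
      Matrix.mulVec_mulVec, hG]
    simp only [Matrix.add_mulVec, Matrix.smul_mulVec, Matrix.one_mulVec, Matrix.vecMulVec_mulVec,
      dotProduct_add, dotProduct_smul, smul_eq_mul, MulOpposite.smul_eq_mul_unop,
      MulOpposite.unop_op, dotProduct_comm x 1, sq]
  rw [← Matrix.l2_opNorm_conjTranspose, Matrix.conjTranspose_eq_transpose_of_trivial,
    Matrix.l2_opNorm_def]
  refine ContinuousLinearMap.opNorm_le_bound _ (Real.sqrt_nonneg _) fun x => ?_
  calc ‖WithLp.toLp 2 (Gᵀ *ᵥ x.ofLp)‖ = √((Gᵀ *ᵥ x.ofLp) ⬝ᵥ (Gᵀ *ᵥ x.ofLp)) := by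
        simp [EuclideanSpace.norm_eq, dotProduct, sq]
    _ ≤ √(α * (x.ofLp ⬝ᵥ x.ofLp)) := by
        rw [hquad]
        exact Real.sqrt_le_sqrt (add_le_of_nonpos_right
          (mul_nonpos_of_nonpos_of_nonneg hβ (sq_nonneg _)))
    _ = √α * ‖x‖ := by
        have hx : 0 ≤ x.ofLp ⬝ᵥ x.ofLp := Finset.sum_nonneg fun i _ => mul_self_nonneg _
        rw [Real.sqrt_mul' _ hx]
        simp [EuclideanSpace.norm_eq, dotProduct, sq]

theorem sum_indicator_sub_mul [Fintype C] [DecidableEq C] (s t : Finset C) (ρ : ℝ) :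
    ∑ j, ((if j ∈ s then 1 else 0) - ρ) * ((if j ∈ t then 1 else 0) - ρ)
      = (s ∩ t).card - ρ * (s.card + t.card) + ρ ^ 2 * Fintype.card C := by
  have hexp (j) : ((if j ∈ s then 1 else 0) - ρ) * ((if j ∈ t then 1 else 0) - ρ)
      = (if j ∈ s ∩ t then 1 else 0) - ρ * (if j ∈ s then 1 else 0)
        - ρ * (if j ∈ t then 1 else 0) + ρ ^ 2 := by
    by_cases hs : j ∈ s <;> by_cases ht : j ∈ t <;>
      simp only [hs, ht, Finset.mem_inter, and_self, and_true, and_false, if_true, if_false] <;>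
      ring
  simp only [hexp, Finset.sum_add_distrib, Finset.sum_sub_distrib, ← Finset.mul_sum,
    Finset.sum_boole, Finset.filter_univ_mem, Finset.sum_const, Finset.card_univ, nsmul_eq_mul]
  ring

theorem indicator_sub_mul_transpose [Fintype C] [DecidableEq C] {B : Type*} [DecidableEq B]
    (s : B → Finset C) {D c ρ : ℝ} (hD : ∀ i, (s i).card = D)
    (hc : ∀ i i', i ≠ i' → (s i ∩ s i').card = c) (hρ : ρ * Fintype.card C = D) :
    (Matrix.of fun i j => (if j ∈ s i then 1 else 0) - ρ)
        * (Matrix.of fun i j => (if j ∈ s i then 1 else 0) - ρ)ᵀ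
      = (D - c) • (1 : Matrix B B ℝ) + (c - ρ * D) • Matrix.vecMulVec 1 1 := by
  ext i i'
  simp only [Matrix.mul_apply, Matrix.transpose_apply, Matrix.of_apply, sum_indicator_sub_mul, hD,
    Matrix.add_apply, Matrix.smul_apply, Matrix.one_apply, Matrix.vecMulVec_apply, Pi.one_apply,
    smul_eq_mul, mul_one]
  split_ifs with h
  · subst h
    rw [Finset.inter_self, hD]
    linear_combination ρ * hρ
  · rw [hc i i' h]
    linear_combination ρ * hρ

theorem div_mul_sqrt_card_le_signRank_mul_sqrt_sub [Fintype C] (S : Matrix R C ℤˣ) {D c : ℕ}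
    (hD : ∀ i, (Finset.univ.filter fun j => S i j = 1).card = D)
    (hc : ∀ i i', i ≠ i' → (Finset.univ.filter fun j => S i j = 1 ∧ S i' j = 1).card = c)
    (hDC : 2 * D ≤ Fintype.card C) (hcC : c * Fintype.card C ≤ D ^ 2) :
    (D / Fintype.card C : ℝ) * √(Fintype.card R * Fintype.card C) ≤ signRank S * √(D - c) := by
  classical
  rcases isEmpty_or_nonempty C with _ | _
  · simpa using by positivity
  have hC : (0 : ℝ) < Fintype.card C := Nat.cast_pos.2 Fintype.card_pos
  set ρ : ℝ := D / Fintype.card C with hρ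
  have hρC : ρ * Fintype.card C = D := div_mul_cancel₀ _ hC.ne'
  have hρ1 : 2 * ρ ≤ 1 := by
    rw [hρ, ← mul_div_assoc]
    exact div_le_one_of_le₀ (by exact_mod_cast hDC) (Nat.cast_nonneg _)
  let G : Matrix R C ℝ :=
    Matrix.of fun i j => (if j ∈ Finset.univ.filter fun j => S i j = 1 then 1 else 0) - ρ
  have hγ (i j) : ρ ≤ ((S i j : ℤ) : ℝ) * G i j := by
    rcases Int.units_eq_one_or (S i j) with h | h
    · simpa [G, h] using (by linarith : ρ ≤ 1 - ρ)
    · simp [G, h]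
  have hgram : G * Gᵀ = (D - c : ℝ) • (1 : Matrix R R ℝ) + (c - ρ * D) • Matrix.vecMulVec 1 1 :=
    indicator_sub_mul_transpose _ (fun i => by rw [hD])
      (fun i i' h => by rw [← Finset.filter_and, hc i i' h]) hρC
  have hβ : c - ρ * D ≤ 0 := by
    refine nonpos_of_mul_nonpos_left (b := (Fintype.card C : ℝ)) ?_ hC
    have hcC' : (c * Fintype.card C : ℝ) ≤ D ^ 2 := by exact_mod_cast hcC
    linear_combination hcC' - D * hρC
  exact (mul_sqrt_card_le_signRank_mul_opNorm S G hγ).trans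
    (mul_le_mul_of_nonneg_left (opNorm_le_sqrt_of_mul_transpose_eq hβ hgram) (Nat.cast_nonneg _))

end SignMatrix

namespace IsProjectiveSpace

variable {P L : Type*} [Membership P L]

theorem exists_line (h : IsProjectiveSpace P L) {p q : P} (hpq : p ≠ q) :
    ∃ l : L, p ∈ l ∧ q ∈ l :=
  (h.existsUnique_line p q hpq).exists

theorem line_eq (h : IsProjectiveSpace P L) {p q : P} (hpq : p ≠ q) {l m : L}
    (hpl : p ∈ l) (hql : q ∈ l) (hpm : p ∈ m) (hqm : q ∈ m) : l = m :=
  (h.existsUnique_line p q hpq).unique ⟨hpl, hql⟩ ⟨hpm, hqm⟩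

theorem exists_mem_mem (h : IsProjectiveSpace P L) {a b c e : P} {ab ce ac be : L}
    (hac : a ≠ c) (hbe : b ≠ e) (ha : a ∈ ab) (hb : b ∈ ab) (hc : c ∈ ce) (he : e ∈ ce)
    (ha' : a ∈ ac) (hc' : c ∈ ac) (hb' : b ∈ be) (he' : e ∈ be)
    (hmeet : ∃ p, p ∈ ab ∧ p ∈ ce) : ∃ q, q ∈ ac ∧ q ∈ be := by
  by_cases hab : a = b
  · exact ⟨a, ha', hab ▸ hb'⟩
  by_cases hae : a = e
  · exact ⟨a, ha', hae ▸ he'⟩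
  by_cases hbc : b = c
  · exact ⟨b, hbc ▸ hc', hb'⟩
  by_cases hce : c = e
  · exact ⟨c, hc', hce ▸ he'⟩
  exact h.veblen_young a b c e ab ce ac be hab hac hae hbc hbe hce ha hb hc he ha' hc' hb' he' hmeet

theorem exists_third_point (h : IsProjectiveSpace P L) (l : L) (p q : P) :
    ∃ r, r ∈ l ∧ r ≠ p ∧ r ≠ q := by
  obtain ⟨a, b, c, hab, hac, hbc, ha, hb, hc⟩ := h.three_points l
  grind

theorem two_le_order_of_line (h : IsProjectiveSpace P L) {n : ℕ} (hn : HasOrder P L n) (l : L) :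
    2 ≤ n := by
  have hcard : {p : P | p ∈ l}.ncard = n + 1 := hn l
  have hthree : 2 < {p : P | p ∈ l}.ncard := by
    rw [Set.two_lt_ncard_iff (Set.finite_of_ncard_pos (hcard ▸ n.succ_pos))]
    obtain ⟨a, b, c, hab, hac, hbc, ha, hb, hc⟩ := h.three_points l
    exact ⟨a, b, c, ha, hb, hc, hab, hac, hbc⟩
  omega

theorem two_le_order (h : IsProjectiveSpace P L) {n d : ℕ} (hn : HasOrder P L n)
    (hd : HasDimension P L (d + 1)) : 2 ≤ n := by
  obtain ⟨B, hB, -⟩ := hd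
  obtain ⟨p, -, q, -, hpq⟩ := Finset.one_lt_card.1 (show 1 < B.card by omega)
  obtain ⟨l, -⟩ := h.exists_line hpq
  exact h.two_le_order_of_line hn l

theorem isSubspace_inter {U W : Set P} (hU : IsSubspace L U) (hW : IsSubspace L W) :
    IsSubspace L (U ∩ W) := fun p hp q hq hpq l hpl hql r hr =>
  ⟨hU p hp.1 q hq.1 hpq l hpl hql r hr, hW p hp.2 q hq.2 hpq l hpl hql r hr⟩

theorem mem_iff_mem_of_collinear {U : Set P} (hU : IsSubspace L U) {p q i : P} {l : L}
    (hp : p ∈ l) (hq : q ∈ l) (hi : i ∈ l) (hpi : p ≠ i) (hqi : q ≠ i) (hiU : i ∈ U) :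
    p ∈ U ↔ q ∈ U :=
  ⟨fun hpU => hU p hpU i hiU hpi l hp hi q hq, fun hqU => hU q hqU i hiU hqi l hq hi p hp⟩

/-- The cone with vertex `p` over `U`: the union of `{p}` and of all lines joining `p` to a point
of `U`. When `U` is a subspace and `p ∉ U` this is the join of `p` and `U`. -/
def cone (L : Type*) [Membership P L] (p : P) (U : Set P) : Set P :=
  {x | x = p ∨ ∃ u ∈ U, ∃ l : L, p ∈ l ∧ u ∈ l ∧ x ∈ l}

theorem self_mem_cone {p : P} {U : Set P} : p ∈ cone L p U :=
  Or.inl rfl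

theorem subset_cone (h : IsProjectiveSpace P L) {p : P} {U : Set P} (hp : p ∉ U) :
    U ⊆ cone L p U := fun u hu => by
  obtain ⟨l, hpl, hul⟩ := h.exists_line (ne_of_mem_of_not_mem hu hp).symm
  exact Or.inr ⟨u, hu, l, hpl, hul, hul⟩

theorem cone_subset {p : P} {U W : Set P} (hW : IsSubspace L W) (hp : p ∉ U) (hUW : U ⊆ W)
    (hpW : p ∈ W) : cone L p U ⊆ W := by
  rintro x (rfl | ⟨u, hu, l, hpl, hul, hxl⟩)
  · exact hpW
  · exact hW p hpW u (hUW hu) (ne_of_mem_of_not_mem hu hp).symm l hpl hul x hxl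

theorem cone_subset_iff (h : IsProjectiveSpace P L) {p : P} {U W : Set P} (hW : IsSubspace L W)
    (hp : p ∉ U) : cone L p U ⊆ W ↔ U ⊆ W ∧ p ∈ W :=
  ⟨fun hc => ⟨(h.subset_cone hp).trans hc, hc self_mem_cone⟩,
    fun hc => cone_subset hW hp hc.1 hc.2⟩

theorem isSubspace_cone (h : IsProjectiveSpace P L) {p : P} {U : Set P} (hU : IsSubspace L U)
    (hp : p ∉ U) : IsSubspace L (cone L p U) := by
  intro x hx y hy hxy l hxl hyl r hrl
  refine or_iff_not_imp_left.2 fun hrp => ?_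
  rcases hx with rfl | ⟨u, hu, m, hpm, hum, hxm⟩ <;>
    rcases hy with rfl | ⟨v, hv, m', hpm', hvm', hym'⟩
  · exact absurd rfl hxy
  · exact ⟨v, hv, m', hpm', hvm', h.line_eq hxy hxl hyl hpm' hym' ▸ hrl⟩
  · exact ⟨u, hu, m, hpm, hum, h.line_eq hxy hxl hyl hxm hpm ▸ hrl⟩
  by_cases huv : u = v
  · subst huv
    have hmm' : m = m' := h.line_eq (ne_of_mem_of_not_mem hu hp) hum hpm hvm' hpm'
    exact ⟨u, hu, m, hpm, hum, h.line_eq hxy hxl hyl hxm (hmm' ▸ hym') ▸ hrl⟩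
  obtain ⟨k, huk, hvk⟩ := h.exists_line huv
  obtain ⟨w, hwl, hwk⟩ : ∃ w, w ∈ l ∧ w ∈ k :=
    h.exists_mem_mem hxy huv hxm hum hym' hvm' hxl hyl huk hvk ⟨p, hpm, hpm'⟩
  obtain ⟨j, hpj, hrj⟩ := h.exists_line (Ne.symm hrp)
  obtain ⟨q, hqj, hqk⟩ : ∃ q, q ∈ j ∧ q ∈ k := by
    by_cases huw : u = w
    · exact h.exists_mem_mem (Ne.symm hrp) (fun hvw => huv (huw.trans hvw.symm))
        hpm' hvm' hrl hwl hpj hrj hvk hwk ⟨y, hym', hyl⟩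
    · exact h.exists_mem_mem (Ne.symm hrp) huw hpm hum hrl hwl hpj hrj huk hwk ⟨x, hxm, hxl⟩
  exact ⟨q, hU u hu v hv huv k huk hvk q hqk, j, hpj, hqj, hrj⟩

theorem ncard_cone [Finite P] (h : IsProjectiveSpace P L) {n : ℕ} (hn : HasOrder P L n)
    {p : P} {U : Set P} (hU : IsSubspace L U) (hp : p ∉ U) :
    (cone L p U).ncard = n * U.ncard + 1 := by
  choose l hpl hul using fun u : U => h.exists_line (ne_of_mem_of_not_mem u.2 hp).symm
  have hcone : cone L p U = insert p (⋃ u : U, {x | x ∈ l u} \ {p}) := by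
    ext x
    simp only [cone, Set.mem_ofPred_eq, Set.mem_insert_iff, Set.mem_iUnion, Set.mem_sdiff,
      Set.mem_singleton_iff]
    refine or_congr_right' fun hxp => ⟨?_, fun ⟨u, hx, _⟩ => ⟨u, u.2, l u, hpl u, hul u, hx⟩⟩
    rintro ⟨u, hu, m, hpm, hum, hxm⟩
    exact ⟨⟨u, hu⟩, h.line_eq (ne_of_mem_of_not_mem hu hp) hum hpm (hul ⟨u, hu⟩) (hpl _) ▸ hxm, hxp⟩
  have hdisj : Pairwise (Function.onFun Disjoint fun u : U => {x | x ∈ l u} \ {p}) := by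
    refine fun u v huv => Set.disjoint_left.2 fun x hxu hxv => hp ?_
    have huv' : l u = l v := h.line_eq hxu.2 hxu.1 (hpl u) hxv.1 (hpl v)
    exact hU u u.2 v v.2 (Subtype.coe_ne_coe.2 huv) (l u) (hul u) (huv' ▸ hul v) p (hpl u)
  have hline (u : U) : ({x | x ∈ l u} \ {p}).ncard = n := by
    have hl : {x | x ∈ l u}.ncard = n + 1 := hn (l u)
    rw [Set.ncard_sdiff_singleton_of_mem (s := {x | x ∈ l u}) (hpl u), hl, Nat.add_sub_cancel]
  rw [hcone, Set.ncard_insert_of_notMem (by simp), Set.ncard_iUnion_of_finite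
    (fun _ => Set.toFinite _) hdisj]
  have := Fintype.ofFinite U
  simp only [hline, finsum_eq_sum_of_fintype, Finset.sum_const, Finset.card_univ, smul_eq_mul,
    Set.ncard_eq_toFinset_card', Set.toFinset_card, mul_comm]

/-- The number `1 + n + ⋯ + n ^ (r - 1)` of points of a flat of rank `r` in a space of order
`n`. -/
def flatCard (n r : ℕ) : ℕ := ∑ i ∈ Finset.range r, n ^ i

theorem flatCard_succ (n r : ℕ) : flatCard n (r + 1) = n * flatCard n r + 1 := by
  rw [flatCard, Finset.sum_range_succ', flatCard, Finset.mul_sum]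
  simp only [pow_succ', pow_zero]

theorem flatCard_succ' (n r : ℕ) : flatCard n (r + 1) = flatCard n r + n ^ r :=
  Finset.sum_range_succ _ _

theorem flatCard_add (n r k : ℕ) : flatCard n (r + k) = flatCard n r + n ^ r * flatCard n k := by
  simp only [flatCard, Finset.sum_range_add, Finset.mul_sum, pow_add]

theorem flatCard_strictMono {n : ℕ} (hn : 0 < n) : StrictMono (flatCard n) :=
  strictMono_nat_of_lt_succ fun r => by
    rw [flatCard_succ']
    exact Nat.lt_add_of_pos_right (pow_pos hn r)

/-- `IsFlat L r U` means that `U` is a flat of rank `r`, a subspace generated by `r` independent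
points; its projective dimension is `r - 1`. -/
inductive IsFlat (L : Type*) [Membership P L] : ℕ → Set P → Prop
  | empty : IsFlat L 0 ∅
  | join {r : ℕ} {U : Set P} {p : P} : IsFlat L r U → p ∉ U → IsFlat L (r + 1) (cone L p U)

theorem isFlat_singleton (p : P) : IsFlat L 1 {p} := by
  simpa [cone] using (IsFlat.empty (L := L)).join (Set.notMem_empty p)

theorem IsFlat.isSubspace (h : IsProjectiveSpace P L) {r : ℕ} {U : Set P} (hU : IsFlat L r U) :
    IsSubspace L U := by
  induction hU with
  | empty => exact fun p hp => hp.elim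
  | join _ hp ih => exact h.isSubspace_cone ih hp

theorem IsFlat.ncard [Finite P] (h : IsProjectiveSpace P L) {n : ℕ} (hn : HasOrder P L n)
    {r : ℕ} {U : Set P} (hU : IsFlat L r U) : U.ncard = flatCard n r := by
  induction hU with
  | empty => simp [flatCard]
  | join hU hp ih => rw [h.ncard_cone hn (hU.isSubspace h) hp, ih, flatCard_succ]

theorem IsFlat.ncard_sdiff [Finite P] (h : IsProjectiveSpace P L) {n : ℕ} (hn : HasOrder P L n)
    {r k : ℕ} {U W : Set P} (hU : IsFlat L r U) (hW : IsFlat L (r + k) W) (hUW : U ⊆ W) :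
    (W \ U).ncard = n ^ r * flatCard n k := by
  rw [Set.ncard_sdiff hUW, hW.ncard h hn, hU.ncard h hn, flatCard_add, Nat.add_sub_cancel_left]

theorem exists_pos_hasOrder (h : IsProjectiveSpace P L) {n : ℕ} (hn : HasOrder P L n) :
    ∃ m, 0 < m ∧ HasOrder P L m := by
  rcases isEmpty_or_nonempty L with _ | ⟨⟨l⟩⟩
  · exact ⟨1, one_pos, isEmptyElim⟩
  · exact ⟨n, two_pos.trans_le (h.two_le_order_of_line hn l), hn⟩

theorem IsFlat.le_of_subset [Finite P] (h : IsProjectiveSpace P L) {n : ℕ}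
    (hn : HasOrder P L n) {r s : ℕ} {U W : Set P} (hU : IsFlat L r U) (hW : IsFlat L s W)
    (hUW : U ⊆ W) : r ≤ s := by
  obtain ⟨m, hm0, hm⟩ := h.exists_pos_hasOrder hn
  rw [← (flatCard_strictMono hm0).le_iff_le, ← hU.ncard h hm, ← hW.ncard h hm]
  exact Set.ncard_le_ncard hUW

theorem IsFlat.lt_of_ssubset [Finite P] (h : IsProjectiveSpace P L) {n : ℕ}
    (hn : HasOrder P L n) {r s : ℕ} {U W : Set P} (hU : IsFlat L r U) (hW : IsFlat L s W)
    (hUW : U ⊂ W) : r < s := by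
  obtain ⟨m, hm0, hm⟩ := h.exists_pos_hasOrder hn
  rw [← (flatCard_strictMono hm0).lt_iff_lt, ← hU.ncard h hm, ← hW.ncard h hm]
  exact Set.ncard_lt_ncard hUW

theorem IsFlat.rank_unique [Finite P] (h : IsProjectiveSpace P L) {n : ℕ}
    (hn : HasOrder P L n) {r s : ℕ} {U : Set P} (hU : IsFlat L r U) (hU' : IsFlat L s U) :
    r = s :=
  (hU.le_of_subset h hn hU' subset_rfl).antisymm (hU'.le_of_subset h hn hU subset_rfl)

theorem exists_isFlat [Finite P] (h : IsProjectiveSpace P L) {W : Set P}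
    (hW : IsSubspace L W) : ∃ r, IsFlat L r W := by
  obtain ⟨U, ⟨⟨r, hr⟩, hUW⟩, hmax⟩ := Set.Finite.exists_maximal
    (s := {U : Set P | (∃ r, IsFlat L r U) ∧ U ⊆ W}) (Set.toFinite _)
    ⟨∅, ⟨0, .empty⟩, Set.empty_subset W⟩
  suffices W ⊆ U from ⟨r, hUW.antisymm this ▸ hr⟩
  by_contra hWU
  obtain ⟨p, hpW, hpU⟩ := Set.not_subset.1 hWU
  exact hpU (hmax ⟨⟨_, hr.join hpU⟩, cone_subset hW hpU hUW hpW⟩ (h.subset_cone hpU) self_mem_cone)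

theorem subset_span (X : Set P) : X ⊆ span L X := fun _ hx _ hU => hU.2 hx

theorem span_subset {X U : Set P} (hU : IsSubspace L U) (hX : X ⊆ U) : span L X ⊆ U :=
  fun _ hx => hx U ⟨hU, hX⟩

theorem isSubspace_span (X : Set P) : IsSubspace L (span L X) :=
  fun p hp q hq hpq l hpl hql r hr U hU =>
    hU.1 p (hp U hU) q (hq U hU) hpq l hpl hql r hr

theorem span_mono {X Y : Set P} (hXY : X ⊆ Y) : span L X ⊆ span L Y :=
  span_subset (isSubspace_span Y) (hXY.trans (subset_span Y))

theorem span_insert (h : IsProjectiveSpace P L) {X : Set P} {p : P} (hp : p ∉ span L X) :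
    span L (insert p X) = cone L p (span L X) := by
  refine Set.Subset.antisymm ?_ ?_
  · exact span_subset (h.isSubspace_cone (isSubspace_span X) hp)
      (Set.insert_subset self_mem_cone ((subset_span X).trans (h.subset_cone hp)))
  · exact cone_subset (isSubspace_span _) hp (span_mono (Set.subset_insert p X))
      (subset_span _ (Set.mem_insert p X))

theorem Independent.mono {X Y : Set P} (hY : Independent L Y) (hXY : X ⊆ Y) : Independent L X :=
  fun x hx hxs => hY x (hXY hx) (span_mono (Set.sdiff_subset_sdiff_left hXY) hxs)

theorem Independent.isFlat_span (h : IsProjectiveSpace P L) {X : Finset P}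
    (hX : Independent L (X : Set P)) : IsFlat L X.card (span L (X : Set P)) := by
  classical
  induction X using Finset.induction_on with
  | empty =>
    have hempty : span L ((∅ : Finset P) : Set P) = ∅ :=
      Set.subset_empty_iff.1 (span_subset (fun p hp => hp.elim) (by simp))
    exact hempty ▸ IsFlat.empty
  | insert p X hpX ih =>
    rw [Finset.coe_insert] at hX
    have hp : p ∉ span L (X : Set P) := by
      simpa [Set.insert_sdiff_self_of_notMem (Finset.mem_coe.not.2 hpX)] using
        hX p (Set.mem_insert p _)
    rw [Finset.card_insert_of_notMem hpX, Finset.coe_insert, h.span_insert hp]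
    exact (ih (hX.mono (Set.subset_insert p _))).join hp

theorem HasDimension.isFlat_univ (h : IsProjectiveSpace P L) {d : ℕ}
    (hd : HasDimension P L d) : IsFlat L (d + 1) (Set.univ : Set P) := by
  obtain ⟨B, hB, hBi, hBs⟩ := hd
  exact hB ▸ hBs ▸ hBi.isFlat_span h

theorem isHyperplane_iff_isFlat [Finite P] (h : IsProjectiveSpace P L) {d n : ℕ}
    (hn : HasOrder P L n) (hd : HasDimension P L d) {U : Set P} :
    IsHyperplane L U ↔ IsFlat L d U := by
  have huniv := hd.isFlat_univ h
  constructor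
  · intro hU
    obtain ⟨r, hr⟩ := h.exists_isFlat hU.prop.1
    obtain ⟨p, hp⟩ := (Set.ne_univ_iff_exists_notMem U).1 hU.prop.2
    have hcone : cone L p U = Set.univ := by
      by_contra hne
      exact hp (hU.le_of_ge ⟨h.isSubspace_cone hU.prop.1 hp, hne⟩ (h.subset_cone hp)
        self_mem_cone)
    have hrd : r + 1 = d + 1 := (hcone ▸ hr.join hp).rank_unique h hn huniv
    exact Nat.succ_injective hrd ▸ hr
  · refine fun hU => ⟨⟨hU.isSubspace h, ?_⟩, fun W hW hUW => ?_⟩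
    · rintro rfl
      exact d.succ_ne_self (huniv.rank_unique h hn hU)
    · by_contra hWU
      obtain ⟨s, hs⟩ := h.exists_isFlat hW.1
      have hds : d < s := hU.lt_of_ssubset h hn hs ⟨hUW, hWU⟩
      have hsd : s < d + 1 := hs.lt_of_ssubset h hn huniv (Set.ssubset_univ_iff.2 hW.2)
      omega

theorem card_points [Fintype P] (h : IsProjectiveSpace P L) {d n : ℕ}
    (hn : HasOrder P L n) (hd : HasDimension P L d) : Fintype.card P = flatCard n (d + 1) := by
  rw [← (hd.isFlat_univ h).ncard h hn, Set.ncard_univ, Nat.card_eq_fintype_card]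

theorem Hyperplane.isSubspace (W : Hyperplane P L) : IsSubspace L W.1 :=
  W.2.prop.1

open Classical in
theorem IsFlat.card_hyperplane_mul [Fintype P] (h : IsProjectiveSpace P L) {n : ℕ}
    (hn : HasOrder P L n) {r k c : ℕ} (hd : HasDimension P L (r + k)) {U : Set P}
    (hU : IsFlat L r U)
    (hc : ∀ p ∉ U, (Finset.univ.filter fun W : Hyperplane P L => cone L p U ⊆ W.1).card = c) :
    (Finset.univ.filter fun W : Hyperplane P L => U ⊆ W.1).card * (n ^ r * flatCard n k)
      = n ^ r * flatCard n (k + 1) * c := by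
  have hcompl : (Finset.univ.filter fun p => p ∉ U).card = n ^ r * flatCard n (k + 1) := by
    rw [← hU.ncard_sdiff h hn (hd.isFlat_univ h) (Set.subset_univ U), ← Set.ncard_coe_finset]
    congr 1
    ext p
    simp
  rw [← hcompl]
  refine Finset.card_mul_eq_card_mul (fun (W : Hyperplane P L) p => p ∈ W.1)
    (fun W hW => ?_) fun p hp => ?_
  · rw [← hU.ncard_sdiff h hn ((h.isHyperplane_iff_isFlat hn hd).1 W.2)
      ((Finset.mem_filter_univ W).1 hW), ← Set.ncard_coe_finset]
    congr 1
    ext p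
    simp [Finset.bipartiteAbove, and_comm]
  · have hpU : p ∉ U := (Finset.mem_filter_univ p).1 hp
    rw [← hc p hpU, Finset.bipartiteBelow, Finset.filter_filter]
    exact congrArg Finset.card
      (Finset.filter_congr fun W _ => (h.cone_subset_iff W.isSubspace hpU).symm)

open Classical in
theorem IsFlat.card_hyperplane [Fintype P] (h : IsProjectiveSpace P L) {n : ℕ}
    (hn : HasOrder P L n) {r k : ℕ} (hd : HasDimension P L (r + k)) {U : Set P}
    (hU : IsFlat L r U) :
    (Finset.univ.filter fun W : Hyperplane P L => U ⊆ W.1).card = flatCard n (k + 1) := by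
  induction k generalizing r U with
  | zero =>
    obtain ⟨V, rfl⟩ : ∃ V : Hyperplane P L, V.1 = U :=
      ⟨⟨U, (h.isHyperplane_iff_isFlat hn hd).2 hU⟩, rfl⟩
    have hsingle : (Finset.univ.filter fun W : Hyperplane P L => V.1 ⊆ W.1) = {V} :=
      Finset.eq_singleton_iff_unique_mem.2 ⟨(Finset.mem_filter_univ V).2 subset_rfl, fun W hW =>
        Subtype.ext (V.2.eq_of_subset W.2.prop ((Finset.mem_filter_univ W).1 hW)).symm⟩
    rw [hsingle, Finset.card_singleton, flatCard_succ, flatCard, Finset.sum_range_zero, mul_zero]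
  | succ k ih =>
    have hpos : 0 < n ^ r * flatCard n (k + 1) := by
      have := h.two_le_order hn hd
      rw [flatCard_succ]
      positivity
    refine Nat.eq_of_mul_eq_mul_right hpos ?_
    rw [hU.card_hyperplane_mul h hn hd fun p hp =>
      ih (Nat.add_right_comm r k 1 ▸ hd) (hU.join hp)]
    ring

theorem card_hyperplane [Fintype P] (h : IsProjectiveSpace P L) {d n : ℕ}
    (hn : HasOrder P L n) (hd : HasDimension P L d) :
    Fintype.card (Hyperplane P L) = flatCard n (d + 1) := by
  classical
  simpa using IsFlat.empty.card_hyperplane h hn (d.zero_add.symm ▸ hd)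

open Classical in
theorem card_hyperplane_mem [Fintype P] (h : IsProjectiveSpace P L) {d n : ℕ}
    (hn : HasOrder P L n) (hd : HasDimension P L (d + 1)) (p : P) :
    (Finset.univ.filter fun W : Hyperplane P L => p ∈ W.1).card = flatCard n (d + 1) := by
  simpa using (isFlat_singleton p).card_hyperplane h hn (d.add_comm 1 ▸ hd)

open Classical in
theorem card_hyperplane_mem_mem [Fintype P] (h : IsProjectiveSpace P L) {d n : ℕ}
    (hn : HasOrder P L n) (hd : HasDimension P L (d + 2)) {p q : P} (hpq : p ≠ q) :
    (Finset.univ.filter fun W : Hyperplane P L => p ∈ W.1 ∧ q ∈ W.1).card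
      = flatCard n (d + 1) := by
  have hq : q ∉ ({p} : Set P) := hpq.symm
  rw [← ((isFlat_singleton p).join hq).card_hyperplane h hn (d.add_comm 2 ▸ hd)]
  refine congrArg Finset.card (Finset.filter_congr fun W _ => ?_)
  rw [h.cone_subset_iff W.isSubspace hq, Set.singleton_subset_iff]

theorem signedIncidence_eq_one {p : P} {W : Hyperplane P L} :
    signedIncidence P L p W = 1 ↔ p ∈ W.1 := by
  by_cases hp : p ∈ W.1 <;> simp [signedIncidence, hp]

theorem signedIncidence_eq_neg_one {p : P} {W : Hyperplane P L} :
    signedIncidence P L p W = -1 ↔ p ∉ W.1 := by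
  by_cases hp : p ∈ W.1 <;> simp [signedIncidence, hp]

theorem exists_isFlat_of_shattered [Finite P] (h : IsProjectiveSpace P L) {d n : ℕ}
    (hn : HasOrder P L n) (hd : HasDimension P L d) {T : Finset (Hyperplane P L)}
    (hT : SignMatrix.Shattered (signedIncidence P L) T) :
    ∃ r, IsFlat L r {x : P | ∀ W ∈ T, x ∈ W.1} ∧ r + T.card ≤ d + 1 := by
  classical
  induction T using Finset.induction_on with
  | empty => exact ⟨d + 1, by simpa using hd.isFlat_univ h, by simp⟩
  | insert W T hW ih =>
    obtain ⟨r, hr, hle⟩ := ih (hT.mono (Finset.subset_insert W T))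
    have hinter : {x : P | ∀ V ∈ insert W T, x ∈ V.1} = {x | ∀ V ∈ T, x ∈ V.1} ∩ W.1 := by
      ext x
      simp [and_comm]
    obtain ⟨s, hs⟩ := h.exists_isFlat (isSubspace_inter (hr.isSubspace h) W.isSubspace)
    obtain ⟨x, hx⟩ := hT fun V => if V = W then -1 else 1
    have hxW : x ∉ W.1 := signedIncidence_eq_neg_one.1
      ((hx W (Finset.mem_insert_self W T)).trans (if_pos rfl))
    have hxT (V) (hV : V ∈ T) : x ∈ V.1 := signedIncidence_eq_one.1
      ((hx V (Finset.mem_insert_of_mem hV)).trans (if_neg (ne_of_mem_of_not_mem hV hW)))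
    have hsr : s < r := hs.lt_of_ssubset h hn hr
      ⟨Set.inter_subset_left, fun hsub => hxW (hsub hxT).2⟩
    refine ⟨s, hinter ▸ hs, ?_⟩
    rw [Finset.card_insert_of_notMem hW]
    omega

theorem card_le_of_shattered [Finite P] (h : IsProjectiveSpace P L) {d n : ℕ}
    (hn : HasOrder P L n) (hd : HasDimension P L d) {T : Finset (Hyperplane P L)}
    (hT : SignMatrix.Shattered (signedIncidence P L) T) : T.card ≤ d := by
  obtain ⟨r, hr, hle⟩ := h.exists_isFlat_of_shattered hn hd hT
  obtain ⟨x, hx⟩ := hT fun _ => 1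
  have hr1 : 1 ≤ r := (isFlat_singleton x).le_of_subset h hn hr
    (Set.singleton_subset_iff.2 fun W hW => signedIncidence_eq_one.1 (hx W hW))
  omega

theorem exists_dual_hyperplanes [Finite P] (h : IsProjectiveSpace P L) {d n : ℕ}
    (hn : HasOrder P L n) (hd : HasDimension P L d) :
    ∃ (e : Fin (d + 1) → P) (F : Fin (d + 1) → Hyperplane P L),
      ∀ i j, e j ∈ (F i).1 ↔ j ≠ i := by
  classical
  obtain ⟨B, hB, hBi, -⟩ := id hd
  let e := (B.equivFinOfCardEq hB).symm
  have hflat (i) : IsFlat L d (span L ((B.erase (e i) : Finset P) : Set P)) := by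
    have := (hBi.mono (Finset.coe_subset.2 (B.erase_subset (e i : P)))).isFlat_span h
    rwa [Finset.card_erase_of_mem (e i).2, hB, Nat.add_sub_cancel] at this
  refine ⟨fun i => e i, fun i => ⟨_, (h.isHyperplane_iff_isFlat hn hd).2 (hflat i)⟩,
    fun i j => ⟨?_, fun hji => subset_span _ ?_⟩⟩
  · rintro hj rfl
    exact hBi (e j) (e j).2 (by simpa using hj)
  · simpa [e.injective.eq_iff, Subtype.val_inj] using hji

theorem exists_forall_mem_iff_notMem (h : IsProjectiveSpace P L) {ι : Type*} {e : ι → P}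
    {F : ι → Set P} (hF : ∀ i, IsSubspace L (F i)) (he : ∀ i j, e j ∈ F i ↔ j ≠ i) {p : P}
    (hp : ∀ i, p ∈ F i) (J : Finset ι) : ∃ q, ∀ i, q ∈ F i ↔ i ∉ J := by
  classical
  induction J using Finset.induction_on with
  | empty => exact ⟨p, by simpa using hp⟩
  | insert j J hj ih =>
    obtain ⟨q, hq⟩ := ih
    have hqj : q ∈ F j := (hq j).2 hj
    have hej : e j ∉ F j := by simp [he]
    have hne : q ≠ e j := ne_of_mem_of_not_mem hqj hej
    obtain ⟨l, hql, hjl⟩ := h.exists_line hne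
    obtain ⟨r, hrl, hrq, hrj⟩ := h.exists_third_point l q (e j)
    refine ⟨r, fun i => ?_⟩
    rcases eq_or_ne i j with rfl | hij
    · simp only [Finset.mem_insert_self, not_true, iff_false]
      exact fun hr => hej ((hF i) q hqj r hr hrq.symm l hql hrl _ hjl)
    · rw [mem_iff_mem_of_collinear (hF i) hrl hql hjl hrj hne ((he i j).2 hij.symm), hq]
      simp [hij]

theorem exists_shattered [Finite P] (h : IsProjectiveSpace P L) {d n : ℕ}
    (hn : HasOrder P L n) (hd : HasDimension P L d) :
    ∃ T : Finset (Hyperplane P L), T.card = d ∧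
      SignMatrix.Shattered (signedIncidence P L) T := by
  classical
  obtain ⟨e, F, he⟩ := h.exists_dual_hyperplanes hn hd
  have hinj : Function.Injective F := fun i j hij => by
    by_contra hne
    exact (he i i).1 (hij ▸ (he j i).2 hne) rfl
  refine ⟨Finset.univ.image fun i : Fin d => F i.succ, ?_, fun v => ?_⟩
  · rw [Finset.card_image_of_injective _ fun i j hij => Fin.succ_injective d (hinj hij),
      Finset.card_fin]
  obtain ⟨p, hp⟩ := h.exists_forall_mem_iff_notMem (fun i : Fin d => (F i.succ).isSubspace)
    (fun i j => (he i.succ j.succ).trans (by simp)) (p := e 0) (fun i => by simp [he, Fin.ext_iff])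
    (Finset.univ.filter fun i => v (F i.succ) = -1)
  refine ⟨p, Finset.forall_mem_image.2 fun i _ => ?_⟩
  have hpi := hp i
  rw [Finset.mem_filter_univ] at hpi
  rcases Int.units_eq_one_or (v (F i.succ)) with hv | hv
  · rw [hv, signedIncidence_eq_one, hpi, hv]
    decide
  · rw [hv, signedIncidence_eq_neg_one, hpi, not_not, hv]

theorem vcDim_signedIncidence [Finite P] (h : IsProjectiveSpace P L) {d n : ℕ}
    (hn : HasOrder P L n) (hd : HasDimension P L d) :
    SignMatrix.vcDim (signedIncidence P L) = d := by
  refine IsGreatest.csSup_eq ⟨h.exists_shattered hn hd, ?_⟩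
  rintro _ ⟨T, rfl, hT⟩
  exact h.card_le_of_shattered hn hd hT

end IsProjectiveSpace

namespace IsProjectiveSpace

theorem cast_flatCard {n : ℕ} (hn : n ≠ 1) (r : ℕ) :
    (flatCard n r : ℝ) = ((n : ℝ) ^ r - 1) / ((n : ℝ) - 1) := by
  rw [flatCard, ← geom_sum_eq (by exact_mod_cast hn)]
  push_cast
  rfl

theorem coprime_flatCard_succ (n r : ℕ) : n.Coprime (flatCard n (r + 1)) := by
  rw [flatCard_succ]
  simp

theorem flatCard_ne_mul_sqrt {n : ℕ} (hn : n ≠ 1) (r k e : ℕ) :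
    (flatCard n (r + 1) : ℝ) ≠ k * √((n : ℝ) ^ (e + 1)) := by
  intro h
  have hsq : flatCard n (r + 1) ^ 2 = k ^ 2 * n ^ (e + 1) := by
    have hsq' : (flatCard n (r + 1) : ℝ) ^ 2 = k ^ 2 * n ^ (e + 1) := by
      rw [h, mul_pow, Real.sq_sqrt (by positivity)]
    exact_mod_cast hsq'
  have hdvd : n ∣ flatCard n (r + 1) ^ 2 :=
    hsq ▸ (dvd_pow_self n e.succ_ne_zero).mul_left _
  exact hn (Nat.eq_one_of_dvd_coprimes ((coprime_flatCard_succ n r).pow_right 2) dvd_rfl hdvd)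

theorem flatCard_succ_mul_pow_le (n r : ℕ) (hr : 2 ≤ flatCard n r) :
    flatCard n (r + 1) * n ^ r ≤ (n * flatCard n r) ^ 2 := by
  have hpow := (flatCard_succ n r).symm.trans (flatCard_succ' n r)
  rw [flatCard_succ]
  zify at hpow hr ⊢
  rw [show (n : ℤ) ^ r = n * flatCard n r + 1 - flatCard n r by linarith]
  nlinarith [mul_nonneg (mul_nonneg n.cast_nonneg (Nat.cast_nonneg (flatCard n r)))
    (sub_nonneg.2 hr)]

theorem mul_flatCard_pow_le (n e : ℕ) :
    (n * flatCard n (e + 1)) ^ e ≤ flatCard n (e + 1) ^ (e + 1) := by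
  rw [mul_pow, pow_succ', flatCard_succ']
  exact Nat.mul_le_mul_right _ (Nat.le_add_left _ _)

theorem rpow_half_eq_sqrt_pow {x : ℝ} (hx : 0 ≤ x) (e : ℕ) :
    x ^ ((((e + 1 : ℕ) : ℝ) - 1) / 2) = √(x ^ e) := by
  rw [Real.sqrt_eq_rpow, ← Real.rpow_natCast_mul hx]
  congr 1
  push_cast
  ring

theorem flatCard_succ_rpow_le {n d : ℕ} (hn : 2 ≤ n) (hd : 2 ≤ d) :
    (flatCard n (d + 1) : ℝ) ^ ((1 : ℝ) / 2 - 1 / (2 * (d : ℝ)))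
      ≤ flatCard n d / (n : ℝ) ^ (((d : ℝ) - 1) / 2) := by
  obtain ⟨e, rfl⟩ := Nat.exists_eq_add_of_le' (one_le_two.trans hd)
  have hD : 2 ≤ flatCard n (e + 1) :=
    hd.trans ((flatCard_strictMono (two_pos.trans_le hn)).id_le _)
  have hpow : (flatCard n (e + 2) * n ^ (e + 1)) ^ e ≤ flatCard n (e + 1) ^ (2 * (e + 1)) :=
    calc (flatCard n (e + 2) * n ^ (e + 1)) ^ e
        ≤ ((n * flatCard n (e + 1)) ^ 2) ^ e :=
          Nat.pow_le_pow_left (flatCard_succ_mul_pow_le n (e + 1) hD) e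
      _ = ((n * flatCard n (e + 1)) ^ e) ^ 2 := pow_right_comm _ _ _
      _ ≤ (flatCard n (e + 1) ^ (e + 1)) ^ 2 := Nat.pow_le_pow_left (mul_flatCard_pow_le n e) 2
      _ = flatCard n (e + 1) ^ (2 * (e + 1)) := by rw [← pow_mul, mul_comm]
  have hn0 : (0 : ℝ) < n := by positivity
  rw [rpow_half_eq_sqrt_pow hn0.le, le_div_iff₀ (by positivity)]
  refine le_of_pow_le_pow_left₀ (n := 2 * (e + 1)) (by positivity) (by positivity) ?_
  calc ((flatCard n (e + 2) : ℝ) ^ ((1 : ℝ) / 2 - 1 / (2 * ((e + 1 : ℕ) : ℝ))) * √((n : ℝ) ^ e))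
        ^ (2 * (e + 1))
      = ((flatCard n (e + 2) : ℝ) * (n : ℝ) ^ (e + 1)) ^ e := by
        rw [mul_pow, mul_pow, ← Real.rpow_mul_natCast (by positivity), pow_mul (√_) 2,
          Real.sq_sqrt (by positivity), ← pow_mul, ← pow_mul, mul_comm e, ← Real.rpow_natCast _ e]
        congr 2
        push_cast
        field_simp
        ring
    _ ≤ (flatCard n (e + 1) : ℝ) ^ (2 * (e + 1)) := by exact_mod_cast hpow

theorem flatCard_div_lt_signRank {P L : Type*} [Membership P L] [Fintype P]
    (h : IsProjectiveSpace P L) {n d : ℕ} (hn : HasOrder P L n) (hd : 2 ≤ d)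
    (hdim : HasDimension P L d) :
    flatCard n d / (n : ℝ) ^ (((d : ℝ) - 1) / 2)
      < SignMatrix.signRank (signedIncidence P L) := by
  classical
  obtain ⟨e, rfl⟩ := Nat.exists_eq_add_of_le' hd
  have hn2 := h.two_le_order hn hdim
  have hN : flatCard n (e + 3) = n * flatCard n (e + 2) + 1 := flatCard_succ n (e + 2)
  have hD : flatCard n (e + 2) = n * flatCard n (e + 1) + 1 := flatCard_succ n (e + 1)
  have hsub : (flatCard n (e + 2) : ℝ) - flatCard n (e + 1) = (n : ℝ) ^ (e + 1) := by
    rw [flatCard_succ' n (e + 1)]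
    push_cast
    ring
  have hle : (flatCard n (e + 2) : ℝ)
      ≤ SignMatrix.signRank (signedIncidence P L) * √((n : ℝ) ^ (e + 1)) := by
    have := SignMatrix.div_mul_sqrt_card_le_signRank_mul_sqrt_sub (signedIncidence P L)
      (D := flatCard n (e + 2)) (c := flatCard n (e + 1))
      (fun p => by simpa only [signedIncidence_eq_one] using h.card_hyperplane_mem hn hdim p)
      (fun p q hpq => by
        simpa only [signedIncidence_eq_one] using h.card_hyperplane_mem_mem hn hdim hpq)
      (by rw [h.card_hyperplane hn hdim, hN]; nlinarith)
      (by rw [h.card_hyperplane hn hdim, hN]; nlinarith)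
    rw [h.card_points hn hdim, h.card_hyperplane hn hdim, Real.sqrt_mul_self (Nat.cast_nonneg _),
      div_mul_cancel₀ _ (Nat.cast_ne_zero.2 (hN ▸ Nat.succ_ne_zero _))] at this
    rwa [hsub] at this
  rw [rpow_half_eq_sqrt_pow n.cast_nonneg, div_lt_iff₀ (by positivity)]
  exact hle.lt_of_ne (flatCard_ne_mul_sqrt (by omega) (e + 1) _ e)

end IsProjectiveSpace

theorem theorem6_general {P L : Type*} [Membership P L] [Fintype P]
    (hPL : IsProjectiveSpace P L) (d n : ℕ) (hd : 2 ≤ d)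
    (hdim : IsProjectiveSpace.HasDimension P L d) (hord : IsProjectiveSpace.HasOrder P L n) :
    (Fintype.card P : ℝ) = ((n : ℝ) ^ (d + 1) - 1) / ((n : ℝ) - 1) ∧
    (Fintype.card (IsProjectiveSpace.Hyperplane P L) : ℝ)
      = ((n : ℝ) ^ (d + 1) - 1) / ((n : ℝ) - 1) ∧
    SignMatrix.vcDim (IsProjectiveSpace.signedIncidence P L) = d ∧
    ((n : ℝ) ^ d - 1) / ((n : ℝ) ^ (((d : ℝ) - 1) / 2) * ((n : ℝ) - 1))
      < (SignMatrix.signRank (IsProjectiveSpace.signedIncidence P L) : ℝ) ∧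
    (((n : ℝ) ^ (d + 1) - 1) / ((n : ℝ) - 1)) ^ ((1 : ℝ) / 2 - 1 / (2 * (d : ℝ)))
      ≤ ((n : ℝ) ^ d - 1) / ((n : ℝ) ^ (((d : ℝ) - 1) / 2) * ((n : ℝ) - 1)) := by
  have hn : 2 ≤ n := hPL.two_le_order hord (d := d - 1) (by rwa [Nat.sub_add_cancel (by omega)])
  have hcast := IsProjectiveSpace.cast_flatCard (n := n) (by omega)
  have hquot : ((n : ℝ) ^ d - 1) / ((n : ℝ) ^ (((d : ℝ) - 1) / 2) * ((n : ℝ) - 1))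
      = IsProjectiveSpace.flatCard n d / (n : ℝ) ^ (((d : ℝ) - 1) / 2) := by
    rw [hcast, div_div, mul_comm]
  rw [hquot, ← hcast]
  exact ⟨congrArg _ (hPL.card_points hord hdim), congrArg _ (hPL.card_hyperplane hord hdim),
    hPL.vcDim_signedIncidence hord hdim, hPL.flatCard_div_lt_signRank hord hd hdim,
    IsProjectiveSpace.flatCard_succ_rpow_le hn hd⟩

theorem theorem6 {P L : Type*} [Membership P L] [Fintype P]
    (hPL : IsProjectiveSpace P L) (d n : ℕ) (hd : 2 ≤ d) (hn : 3 ≤ n)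
    (hdim : IsProjectiveSpace.HasDimension P L d) (hord : IsProjectiveSpace.HasOrder P L n) :
    (Fintype.card P : ℝ) = ((n : ℝ) ^ (d + 1) - 1) / ((n : ℝ) - 1) ∧
    (Fintype.card (IsProjectiveSpace.Hyperplane P L) : ℝ)
      = ((n : ℝ) ^ (d + 1) - 1) / ((n : ℝ) - 1) ∧
    SignMatrix.vcDim (IsProjectiveSpace.signedIncidence P L) = d ∧
    ((n : ℝ) ^ d - 1) / ((n : ℝ) ^ (((d : ℝ) - 1) / 2) * ((n : ℝ) - 1))
      < (SignMatrix.signRank (IsProjectiveSpace.signedIncidence P L) : ℝ) ∧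
    (((n : ℝ) ^ (d + 1) - 1) / ((n : ℝ) - 1)) ^ ((1 : ℝ) / 2 - 1 / (2 * (d : ℝ)))
      ≤ ((n : ℝ) ^ d - 1) / ((n : ℝ) ^ (((d : ℝ) - 1) / 2) * ((n : ℝ) - 1)) :=
  theorem6_general hPL d n hd hdim hord
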